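/- Let $\mathbb H_+=\{\zeta\in\mathbb C:\operatorname{Im}\zeta>0\}$ and let $H^2$ be the Hardy space of all functions $f$ analytic in $\mathbb H_+$ with $\sup_{y>0}\|f(\cdot+iy)\|_{L^2(\mathbb R)}<\infty$. Every $f\in H^2$ has boundary data in $L^2(\mathbb R)$, the $L^2(\mathbb R)$-limit of $f(\cdot+iy)$ as $y\downarrow0$, again denoted by $f$; put $\|f\|_{H^2}=\|f\|_{L^2(\mathbb R)}$, and let $\|f\|_{L^2(-1,1)}$ be the $L^2(-1,1)$ norm of the boundary data. Let $z=z_r+iz_i\in\mathbb H_+$, and put $$\gamma(z)=-\frac1\pi\arg\frac{z+1}{z-1},\qquad \rho>0,\quad \rho^{-2}=\frac{z_i}{9}\Big(\arctan\frac{z_r+1}{z_i}-\arctan\frac{z_r-1}{z_i}\Big),$$ where $\arg$ is the principal argument. Then $\gamma(z)\in(0,1)$, and $\pi\gamma(z)$ is the angle under which the segment $[-1,1]$ is seen from $z$. (Upper bound.) If $\epsilon\in(0,1)$ and $f\in H^2$ satisfies $\|f\|_{H^2}\le1$ and $\|f\|_{L^2(-1,1)}\le\epsilon$, then $$|f(z)|\le\rho\,\epsilon^{\gamma(z)}.$$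 (Optimality.) With $p(\zeta)=i/(\zeta-\overline z)$ and the principal branch of $\ln$, let $$W_\epsilon(\zeta)=\epsilon\,\frac{p(\zeta)}{\|p\|_{L^2(-1,1)}}\exp\Big(\frac{i}{\pi}\ln\epsilon\,\ln\frac{1+\zeta}{1-\zeta}\Big),\qquad \zeta\in\mathbb H_+.$$ There are constants $c,C>0$, depending on $z$ but not on $\epsilon$, such that for every $\epsilon\in(0,1)$: $W_\epsilon\in H^2$, $\|W_\epsilon\|_{L^2(-1,1)}=\epsilon$, $\|W_\epsilon\|_{H^2}\le C$, the function $f=C^{-1}W_\epsilon$ satisfies $f\in H^2$, $\|f\|_{H^2}\le1$, $\|f\|_{L^2(-1,1)}\le\epsilon$, and $$|W_\epsilon(z)|=c\,\rho\,\epsilon^{\gamma(z)}.$$ -/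

import Mathlib

open MeasureTheory Filter Topology Set

namespace HalfPlane

/-- The Hardy space `H²` of the upper half-plane: `f` is analytic in `{Im ζ > 0}` and
`sup_{y > 0} ‖f(· + iy)‖_{L²(ℝ)} < ∞`. -/
def MemH2 (f : ℂ → ℂ) : Prop :=
  DifferentiableOn ℂ f {ζ : ℂ | 0 < ζ.im} ∧
    (⨆ (y : ℝ) (_ : 0 < y), eLpNorm (fun x : ℝ => f (x + y * Complex.I)) 2 volume) < ⊤

/-- `g ∈ L²(ℝ)` is the boundary function of `f`: `f(· + iy) → g` in `L²(ℝ)` as `y ↓ 0`.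
Such a `g` is unique up to null sets. -/
def IsBoundaryValue (f : ℂ → ℂ) (g : ℝ → ℂ) : Prop :=
  MemLp g 2 volume ∧
    Tendsto (fun y : ℝ => eLpNorm (fun x : ℝ => f (x + y * Complex.I) - g x) 2 volume)
      (𝓝[>] 0) (𝓝 0)

open Classical in
/-- The `L²` boundary data of `f` on the real line, as a representative of its class modulo null
sets. (The default value `0` occurs only if there is no boundary function, which never happens
for `f ∈ H²`.) -/
noncomputable def boundaryValue (f : ℂ → ℂ) : ℝ → ℂ :=
  if h : ∃ g, IsBoundaryValue f g then h.choose else 0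

/-- `‖f‖_{H²} = ‖f‖_{L²(ℝ)}`, the `L²(ℝ)` norm of the boundary data. -/
noncomputable def h2Norm (f : ℂ → ℂ) : ENNReal :=
  eLpNorm (boundaryValue f) 2 volume

/-- `‖f‖_{L²(-1,1)}`, the `L²(-1,1)` norm of the boundary data. -/
noncomputable def intervalNorm (f : ℂ → ℂ) : ENNReal :=
  eLpNorm (boundaryValue f) 2 (volume.restrict (Ioo (-1) 1))

/-- The functions competing in the extrapolation problem:
`f ∈ H²`, `‖f‖_{H²} ≤ 1` and `‖f‖_{L²(-1,1)} ≤ ε`. -/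
def Admissible (ε : ℝ) (f : ℂ → ℂ) : Prop :=
  MemH2 f ∧ h2Norm f ≤ 1 ∧ intervalNorm f ≤ ENNReal.ofReal ε

/-- The exponent `γ(z) = -(1/π) arg ((z + 1)/(z - 1))`. -/
noncomputable def gammaExp (z : ℂ) : ℝ :=
  -(1 / Real.pi) * Complex.arg ((z + 1) / (z - 1))

/-- The positive number `ρ` with
`ρ⁻² = (z_i / 9) (arctan ((z_r + 1) / z_i) - arctan ((z_r - 1) / z_i))`. -/
noncomputable def rho (z : ℂ) : ℝ :=
  (√(z.im / 9 * (Real.arctan ((z.re + 1) / z.im) - Real.arctan ((z.re - 1) / z.im))))⁻¹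

/-- `p(ζ) = i / (ζ - z̄)`. -/
noncomputable def kernelP (z ζ : ℂ) : ℂ :=
  Complex.I / (ζ - (starRingEnd ℂ) z)

/-- `‖p‖_{L²(-1,1)}`. -/
noncomputable def kernelPNorm (z : ℂ) : ℝ :=
  (eLpNorm (fun x : ℝ => kernelP z x) 2 (volume.restrict (Ioo (-1) 1))).toReal

/-- `W(ζ) = ε p(ζ) / ‖p‖_{L²(-1,1)} · exp ((i/π) ln ε ln ((1 + ζ)/(1 - ζ)))`, with the principal
branch of the logarithm. -/
noncomputable def maximizerW (z : ℂ) (ε : ℝ) (ζ : ℂ) : ℂ :=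
  (ε : ℂ) * (kernelP z ζ / (kernelPNorm z : ℂ)) *
    Complex.exp (Complex.I / (Real.pi : ℂ) * (Real.log ε : ℂ) * Complex.log ((1 + ζ) / (1 - ζ)))

end HalfPlane

/-! Upper bound. The bounded harmonic function arg((1 + ζ)/(1 - ζ))/π has boundary values 0 on
(-1,1) and 1 off [-1,1], and equals 1 - γ(z) at z. Hence `outerFactor L` with L = -ln ε has modulus
1 on the interval, ε on the rest of the line, and ε^(1-γ(z)) at z. Multiplying an admissible f by it
makes the boundary data small everywhere: interval and complement each contribute at most ε² to the
squared norm. Point evaluation, π Im(z) |F(z)|² ≤ 2‖F‖², applied to the product and divided by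
ε^(1-γ), yields the rate ε^γ. The evaluation constant is not sharp, but ρ² π Im(z) ≥ 9 leaves room
for it.

Boundary data. By Cauchy's theorem the inner product of the slices of f at heights a and b depends
only on a + b. The parallelogram identity then makes the squared slice norm midpoint convex in the
height; being bounded, it is nonincreasing, and the slices are Cauchy in L² as the height decreases
to 0. The limit also dominates every slice, so a bound on the boundary data controls point values.

Optimality. W uses the opposite sign, L = ln ε. Its outer factor has modulus 1 on (-1,1) and at most
1/ε in the half-plane, so ε times it is bounded by 1 and |W| ≤ |p|/‖p‖ uniformly in ε, the norm of p
being that of L²(-1,1). At z the modulus is a constant times ε · ε^(γ-1) = ε^γ. -/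

namespace HalfPlane

/-! ### Existence of boundary values in H². -/

/-- Horizontal contour shift: if `G` is holomorphic in a strip and its `L¹` norms on the lines
`Im ζ = t`, `c ≤ t ≤ d`, are bounded, then the integrals of `G` over the lines at heights `c` and
`d` agree. -/
theorem integral_horizontal_line_eq {G : ℂ → ℂ} {a b c d : ℝ} {M : ENNReal}
    (hG : DifferentiableOn ℂ G {ζ : ℂ | a < ζ.im ∧ ζ.im < b}) (hac : a < c) (hcd : c ≤ d)
    (hdb : d < b) (hM : M ≠ ⊤)
    (hint : ∀ t ∈ Icc c d, ∫⁻ x : ℝ, ‖G (x + t * Complex.I)‖ₑ ≤ M) :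
    ∫ x : ℝ, G (x + c * Complex.I) = ∫ x : ℝ, G (x + d * Complex.I) := by
  have hcont : ContinuousOn (fun p : ℝ × ℝ => G (p.1 + p.2 * Complex.I)) (univ ×ˢ Icc c d) := by
    refine hG.continuousOn.comp (by fun_prop) ?_
    rintro ⟨x, t⟩ ⟨-, ht⟩
    simp only [mem_ofPred_eq, Complex.add_im, Complex.ofReal_im, Complex.mul_im, Complex.ofReal_re,
      Complex.I_im, Complex.I_re, mul_one, mul_zero, zero_add, add_zero]
    exact ⟨hac.trans_le ht.1, ht.2.trans_lt hdb⟩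
  have hline : ∀ t ∈ Icc c d, Integrable (fun x : ℝ => G (x + t * Complex.I)) := by
    intro t ht
    refine ⟨Continuous.aestronglyMeasurable ?_, (hint t ht).trans_lt hM.lt_top⟩
    rw [← continuousOn_univ]
    exact hcont.comp (f := fun x : ℝ => (x, t)) (by fun_prop) (fun x _ => ⟨mem_univ _, ht⟩)
  have hprod : Integrable (fun p : ℝ × ℝ => G (p.1 + p.2 * Complex.I))
      (volume.prod (volume.restrict (Icc c d))) := by
    have hmeas : AEStronglyMeasurable (fun p : ℝ × ℝ => G (p.1 + p.2 * Complex.I))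
        (volume.prod (volume.restrict (Icc c d))) := by
      have := hcont.aestronglyMeasurable (μ := (volume : Measure (ℝ × ℝ)))
        (MeasurableSet.univ.prod measurableSet_Icc)
      rwa [Measure.volume_eq_prod, ← Measure.prod_restrict, Measure.restrict_univ] at this
    refine ⟨hmeas, ?_⟩
    rw [hasFiniteIntegral_iff_enorm, lintegral_prod_symm _ hmeas.enorm]
    calc ∫⁻ t in Icc c d, ∫⁻ x : ℝ, ‖G (x + t * Complex.I)‖ₑ
        ≤ ∫⁻ _ in Icc c d, M := setLIntegral_mono' measurableSet_Icc hint
      _ < ⊤ := by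
        rw [setLIntegral_const]
        exact ENNReal.mul_lt_top hM.lt_top (by simp)
  -- `V` collects the vertical sides of the rectangles; Fubini makes it integrable in the abscissa.
  set V : ℝ → ℂ := fun x => ∫ t in c..d, G (x + t * Complex.I) with hV
  have hVint : Integrable V := by
    have := hprod.integral_prod_left
    simpa only [hV, intervalIntegral.integral_of_le hcd, ← integral_Icc_eq_integral_Ioc] using this
  have hrect : ∀ R : ℝ, (∫ x in (-R)..R, G (x + c * Complex.I)) -
      (∫ x in (-R)..R, G (x + d * Complex.I)) = Complex.I • V (-R) - Complex.I • V R := by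
    intro R
    have := Complex.integral_boundary_rect_eq_zero_of_differentiableOn G
      ⟨-R, c⟩ ⟨R, d⟩ (hG.mono ?_)
    · simp only [hV]
      linear_combination this
    · rintro ζ ⟨-, hζ⟩
      simp only [uIcc_of_le hcd, mem_preimage] at hζ
      exact ⟨hac.trans_le hζ.1, hζ.2.trans_lt hdb⟩
  have hlim : Tendsto (fun R : ℝ => (∫ x in (-R)..R, G (x + c * Complex.I)) -
      (∫ x in (-R)..R, G (x + d * Complex.I))) atTop
      (𝓝 ((∫ x : ℝ, G (x + c * Complex.I)) - ∫ x : ℝ, G (x + d * Complex.I))) :=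
    (intervalIntegral_tendsto_integral (hline c ⟨le_rfl, hcd⟩) tendsto_neg_atTop_atBot
      tendsto_id).sub (intervalIntegral_tendsto_integral (hline d ⟨hcd, le_rfl⟩)
      tendsto_neg_atTop_atBot tendsto_id)
  -- The side terms converge because the horizontal integrals do, and they are integrable in `R`, so
  -- their limit can only be 0. No pointwise decay of `G` is needed.
  have hzero := IntegrableAtFilter.eq_zero_of_tendsto (μ := (volume : Measure ℝ)) (l := atTop)
    (f := fun R => Complex.I • V (-R) - Complex.I • V R) ?_ ?_
    (hlim.congr hrect)
  · exact sub_eq_zero.mp hzero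
  · exact ((hVint.comp_neg.smul Complex.I).sub (hVint.smul Complex.I)).integrableAtFilter _
  · intro s hs
    obtain ⟨r, hr⟩ := mem_atTop_sets.mp hs
    exact top_le_iff.mp ((Real.volume_Ici (a := r)).symm.le.trans (measure_mono fun x hx => hr x hx))

/-- A midpoint convex function on `(0, ∞)` that is bounded above is nonincreasing. -/
theorem antitoneOn_of_midpoint_convex_of_bounded {φ : ℝ → ℝ} {M : ℝ}
    (hconv : ∀ a b, 0 < a → 0 < b → 2 * φ ((a + b) / 2) ≤ φ a + φ b)
    (hM : ∀ a, 0 < a → φ a ≤ M) : AntitoneOn φ (Ioi 0) := by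
  intro a ha b hb hab
  by_contra! hlt
  have ha : 0 < a := ha
  set d := b - a with hd
  have hd0 : 0 ≤ d := by linarith
  -- Midpoint convexity makes increments along an arithmetic progression nondecreasing, so one
  -- strict increase forces linear growth past `M`.
  have hstep : ∀ n : ℕ, φ b - φ a ≤ φ (a + (n + 1) * d) - φ (a + n * d) := by
    intro n
    induction n with
    | zero => simp [hd]
    | succ n ih =>
      have h := hconv (a + n * d) (a + (n + 2) * d) (by positivity) (by positivity)
      rw [show (a + n * d + (a + (n + 2) * d)) / 2 = a + (n + 1) * d by ring] at h
      push_cast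
      rw [show a + ((n : ℝ) + 1 + 1) * d = a + (n + 2) * d by ring]
      linarith
  have hgrow : ∀ n : ℕ, φ a + n * (φ b - φ a) ≤ φ (a + n * d) := by
    intro n
    induction n with
    | zero => simp
    | succ n ih =>
      have := hstep n
      push_cast
      linarith
  obtain ⟨n, hn⟩ := exists_nat_gt ((M - φ a) / (φ b - φ a))
  rw [div_lt_iff₀ (by linarith)] at hn
  linarith [hgrow n, hM (a + n * d) (by positivity)]

/-- A bounded curve in a Hilbert space whose Gram kernel `⟪u a, u b⟫` depends only on `a + b`
converges as the parameter decreases to `0`, and the limit dominates it in norm. -/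
theorem exists_tendsto_of_inner_eq {E : Type*} [NormedAddCommGroup E] [InnerProductSpace ℂ E]
    [CompleteSpace E] {u : ℝ → E} {M : ℝ}
    (hinner : ∀ a b, 0 < a → 0 < b →
      inner ℂ (u a) (u b) = inner ℂ (u ((a + b) / 2)) (u ((a + b) / 2)))
    (hM : ∀ a, 0 < a → ‖u a‖ ≤ M) :
    ∃ g, Tendsto u (𝓝[>] 0) (𝓝 g) ∧ ∀ a, 0 < a → ‖u a‖ ≤ ‖g‖ := by
  have hdist : ∀ a b, 0 < a → 0 < b →
      ‖u a - u b‖ ^ 2 = ‖u a‖ ^ 2 + ‖u b‖ ^ 2 - 2 * ‖u ((a + b) / 2)‖ ^ 2 := by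
    intro a b ha hb
    rw [@norm_sub_sq ℂ, hinner a b ha hb, inner_self_eq_norm_sq]
    ring
  have hanti : AntitoneOn (fun a => ‖u a‖ ^ 2) (Ioi 0) := by
    refine antitoneOn_of_midpoint_convex_of_bounded (M := M ^ 2) (fun a b ha hb => ?_)
      (fun a ha => pow_le_pow_left₀ (norm_nonneg _) (hM a ha) 2)
    have := hdist a b ha hb
    have := sq_nonneg ‖u a - u b‖
    linarith
  have hbdd : BddAbove ((fun a => ‖u a‖ ^ 2) '' Ioi 0) := by
    refine ⟨M ^ 2, ?_⟩
    rintro _ ⟨a, ha, rfl⟩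
    exact pow_le_pow_left₀ (norm_nonneg _) (hM a ha) 2
  have hle : ∀ a, 0 < a → ‖u a‖ ^ 2 ≤ sSup ((fun a => ‖u a‖ ^ 2) '' Ioi 0) :=
    fun a ha => le_csSup hbdd ⟨a, ha, rfl⟩
  have hlim := hanti.tendsto_nhdsGT hbdd
  set l := sSup ((fun a => ‖u a‖ ^ 2) '' Ioi 0)
  have hcauchy : Cauchy (map u (𝓝[>] (0 : ℝ))) := by
    rw [Metric.cauchy_iff]
    refine ⟨inferInstance, fun ε hε => ?_⟩
    -- With ε²/4 here, `hdist` bounds the squared distance by 2l - 2(l - ε²/4) = ε²/2.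
    have hev : ∀ᶠ a in 𝓝[>] (0 : ℝ), l - ε ^ 2 / 4 < ‖u a‖ ^ 2 :=
      hlim.eventually (lt_mem_nhds (by nlinarith))
    obtain ⟨δ, hδ, hsub⟩ := mem_nhdsGT_iff_exists_Ioo_subset.mp hev
    refine ⟨u '' Ioo 0 δ, image_mem_map (Ioo_mem_nhdsGT hδ), ?_⟩
    rintro _ ⟨a, ha, rfl⟩ _ ⟨b, hb, rfl⟩
    rw [dist_eq_norm]
    refine lt_of_pow_lt_pow_left₀ 2 hε.le ?_
    have h1 := hsub (show (a + b) / 2 ∈ Ioo 0 δ from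
      ⟨by linarith [ha.1, hb.1], by linarith [ha.2, hb.2]⟩)
    simp only [mem_ofPred_eq] at h1
    rw [hdist a b ha.1 hb.1]
    have := hle a ha.1
    have := hle b hb.1
    nlinarith
  obtain ⟨g, hg⟩ := cauchy_map_iff_exists_tendsto.mp hcauchy
  refine ⟨g, hg, fun a ha => ?_⟩
  have hgl : ‖g‖ ^ 2 = l := tendsto_nhds_unique (hg.norm.pow 2) hlim
  exact le_of_sq_le_sq (by rw [hgl]; exact hle a ha) (norm_nonneg _)

theorem continuous_horizontal_line {f : ℂ → ℂ} (hf : ContinuousOn f {ζ : ℂ | 0 < ζ.im}) {y : ℝ}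
    (hy : 0 < y) : Continuous (fun x : ℝ => f (x + y * Complex.I)) := by
  rw [← continuousOn_univ]
  exact hf.comp (by fun_prop) (fun x _ => by simpa using hy)

theorem MemH2.continuous_line {f : ℂ → ℂ} (hf : MemH2 f) {y : ℝ} (hy : 0 < y) :
    Continuous (fun x : ℝ => f (x + y * Complex.I)) :=
  continuous_horizontal_line hf.1.continuousOn hy

theorem MemH2.eLpNorm_line_le {f : ℂ → ℂ} {y : ℝ} (hy : 0 < y) :
    eLpNorm (fun x : ℝ => f (x + y * Complex.I)) 2 volume ≤
      ⨆ (y : ℝ) (_ : 0 < y), eLpNorm (fun x : ℝ => f (x + y * Complex.I)) 2 volume :=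
  le_iSup₂ (f := fun (y : ℝ) (_ : 0 < y) =>
    eLpNorm (fun x : ℝ => f (x + y * Complex.I)) 2 volume) y hy

theorem MemH2.memLp_line {f : ℂ → ℂ} (hf : MemH2 f) {y : ℝ} (hy : 0 < y) :
    MemLp (fun x : ℝ => f (x + y * Complex.I)) 2 volume :=
  ⟨(hf.continuous_line hy).aestronglyMeasurable, (MemH2.eLpNorm_line_le hy).trans_lt hf.2⟩

/-- For `f ∈ H²` the `L²` inner product of the slices at heights `a` and `b` depends only
on `a + b`. -/
theorem MemH2.integral_conj_mul_eq {f : ℂ → ℂ} (hf : MemH2 f) {a b : ℝ} (ha : 0 < a) (hab : a ≤ b) :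
    ∫ x : ℝ, f (x + a * Complex.I) * (starRingEnd ℂ) (f (x + b * Complex.I)) =
      ∫ x : ℝ, f (x + ((a + b) / 2 : ℝ) * Complex.I) *
        (starRingEnd ℂ) (f (x + ((a + b) / 2 : ℝ) * Complex.I)) := by
  set N := ⨆ (y : ℝ) (_ : 0 < y), eLpNorm (fun x : ℝ => f (x + y * Complex.I)) 2 volume with hN
  -- Reflection in the line Im ζ = (a + b)/2 combined with conjugation keeps the second factor
  -- holomorphic where Im ζ < a + b.
  set G : ℂ → ℂ := fun ζ =>
    f ζ * (starRingEnd ℂ) (f ((starRingEnd ℂ) (ζ - (a + b : ℝ) * Complex.I))) with hGdef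
  have hGline : ∀ t x : ℝ, G (x + t * Complex.I) =
      f (x + t * Complex.I) * (starRingEnd ℂ) (f (x + (a + b - t : ℝ) * Complex.I)) := by
    intro t x
    simp only [hGdef]
    congr 3
    simp only [map_sub, map_add, map_mul, Complex.conj_ofReal, Complex.conj_I, Complex.ofReal_add,
      Complex.ofReal_sub]
    ring
  have hG : DifferentiableOn ℂ G {ζ : ℂ | 0 < ζ.im ∧ ζ.im < a + b} := by
    refine (hf.1.mono fun ζ h => h.1).mul ?_
    intro ζ hζ
    have hopen : IsOpen {ζ : ℂ | 0 < ζ.im} := isOpen_lt continuous_const Complex.continuous_im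
    have h1 : DifferentiableAt ℂ f ((starRingEnd ℂ) (ζ - (a + b : ℝ) * Complex.I)) := by
      refine hf.1.differentiableAt (hopen.mem_nhds ?_)
      simp only [mem_ofPred_eq, Complex.conj_im, Complex.sub_im, Complex.mul_im,
        Complex.ofReal_re, Complex.ofReal_im, Complex.I_im, Complex.I_re]
      linarith [hζ.2]
    have h2 : DifferentiableAt ℂ ((starRingEnd ℂ) ∘ f ∘ (starRingEnd ℂ))
        (ζ - (a + b : ℝ) * Complex.I) := by
      have := h1.conj_conj
      rwa [Complex.conj_conj] at this
    exact (h2.comp (f := fun ζ : ℂ => ζ - (a + b : ℝ) * Complex.I) ζ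
      (by fun_prop)).differentiableWithinAt
  have key := integral_horizontal_line_eq (c := a) (d := (a + b) / 2) (M := N * N) hG ha
    (by linarith) (by linarith) (ENNReal.mul_ne_top hf.2.ne hf.2.ne) ?_
  · simp only [hGline] at key
    rw [show a + b - a = b by ring, show a + b - (a + b) / 2 = (a + b) / 2 by ring] at key
    exact key
  · intro t ht
    have ht0 : 0 < t := ha.trans_le ht.1
    have ht1 : 0 < a + b - t := by linarith [ht.2]
    calc ∫⁻ x : ℝ, ‖G (x + t * Complex.I)‖ₑ
        = ∫⁻ x : ℝ, ‖f (x + t * Complex.I)‖ₑ * ‖f (x + (a + b - t : ℝ) * Complex.I)‖ₑ := by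
          simp only [hGline, enorm_mul, RCLike.enorm_conj]
      _ ≤ eLpNorm (fun x : ℝ => f (x + t * Complex.I)) 2 volume *
          eLpNorm (fun x : ℝ => f (x + (a + b - t : ℝ) * Complex.I)) 2 volume := by
          have := ENNReal.lintegral_mul_le_Lp_mul_Lq volume Real.HolderConjugate.two_two
            (hf.continuous_line ht0).enorm.aemeasurable
            (hf.continuous_line ht1).enorm.aemeasurable
          simpa [eLpNorm_eq_lintegral_rpow_enorm_toReal] using this
      _ ≤ N * N := mul_le_mul' (MemH2.eLpNorm_line_le ht0) (MemH2.eLpNorm_line_le ht1)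

/-- Every `f ∈ H²` has a boundary function, whose `L²` norm dominates those of all slices. -/
theorem MemH2.exists_isBoundaryValue {f : ℂ → ℂ} (hf : MemH2 f) :
    ∃ g, IsBoundaryValue f g ∧ ∀ y : ℝ, 0 < y →
      eLpNorm (fun x : ℝ => f (x + y * Complex.I)) 2 volume ≤ eLpNorm g 2 volume := by
  classical
  set N := ⨆ (y : ℝ) (_ : 0 < y), eLpNorm (fun x : ℝ => f (x + y * Complex.I)) 2 volume with hN
  -- The value 0 at nonpositive heights is a dummy: only limits from the right at 0 are taken.
  set u : ℝ → Lp ℂ 2 (volume : Measure ℝ) := fun y =>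
    if hy : 0 < y then (hf.memLp_line hy).toLp _ else 0 with hu
  have hupos : ∀ y (hy : 0 < y), u y = (hf.memLp_line hy).toLp _ := fun y hy => dif_pos hy
  have hinner : ∀ a b, 0 < a → 0 < b → inner ℂ (u a) (u b) =
      ∫ x : ℝ, f (x + b * Complex.I) * (starRingEnd ℂ) (f (x + a * Complex.I)) := by
    intro a b ha hb
    rw [hupos a ha, hupos b hb, L2.inner_def]
    refine integral_congr_ae ?_
    filter_upwards [(hf.memLp_line ha).coeFn_toLp, (hf.memLp_line hb).coeFn_toLp] with x h1 h2
    rw [h1, h2, RCLike.inner_apply]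
  have hsum : ∀ a b, 0 < a → 0 < b → b ≤ a →
      inner ℂ (u a) (u b) = inner ℂ (u ((a + b) / 2)) (u ((a + b) / 2)) := by
    intro a b ha hb hba
    have hm : 0 < (a + b) / 2 := by linarith
    rw [hinner a b ha hb, hinner _ _ hm hm, hf.integral_conj_mul_eq hb hba, add_comm b a]
  have hsum' : ∀ a b, 0 < a → 0 < b →
      inner ℂ (u a) (u b) = inner ℂ (u ((a + b) / 2)) (u ((a + b) / 2)) := by
    intro a b ha hb
    rcases le_total b a with hba | hab
    · exact hsum a b ha hb hba
    · have h := hsum b a hb ha hab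
      rw [add_comm b a] at h
      rw [← inner_conj_symm, h, inner_conj_symm]
  have hbound : ∀ a, 0 < a → ‖u a‖ ≤ N.toReal := by
    intro a ha
    rw [hupos a ha, Lp.norm_toLp]
    exact ENNReal.toReal_mono hf.2.ne (MemH2.eLpNorm_line_le ha)
  obtain ⟨g, hg, hle⟩ := exists_tendsto_of_inner_eq (u := u) (M := N.toReal) hsum' hbound
  refine ⟨g, ⟨Lp.memLp g, ?_⟩, fun y hy => ?_⟩
  · have h1 : Tendsto (fun y => edist (u y) g) (𝓝[>] 0) (𝓝 0) := by
      simpa using tendsto_iff_edist_tendsto_0.mp hg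
    refine h1.congr' ?_
    filter_upwards [self_mem_nhdsWithin] with y hy
    rw [Lp.edist_def, hupos y hy]
    refine eLpNorm_congr_ae ?_
    filter_upwards [(hf.memLp_line hy).coeFn_toLp] with x h
    simp [h]
  · have h1 := hle y hy
    rw [hupos y hy, Lp.norm_def, Lp.norm_def,
      ENNReal.toReal_le_toReal (Lp.eLpNorm_ne_top _) (Lp.eLpNorm_ne_top _)] at h1
    rwa [eLpNorm_congr_ae (hf.memLp_line hy).coeFn_toLp] at h1

/-! ### Point evaluation by area means. -/

theorem eLpNorm_two_sq {α E : Type*} [MeasurableSpace α] [NormedAddCommGroup E] (f : α → E)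
    (μ : Measure α) : eLpNorm f 2 μ ^ 2 = ∫⁻ x, ‖f x‖ₑ ^ 2 ∂μ := by
  have h := eLpNorm_nnreal_pow_eq_lintegral (f := f) (μ := μ) (p := 2) two_ne_zero
  simpa using h

/-- Sub-mean value property of `‖F‖²` over circles. -/
theorem two_pi_mul_enorm_sq_le_lintegral_circle {F : ℂ → ℂ} {z : ℂ} {r : ℝ}
    (hF : DifferentiableOn ℂ F (Metric.closedBall z |r|)) :
    ENNReal.ofReal (2 * Real.pi) * ‖F z‖ₑ ^ 2 ≤
      ∫⁻ θ in Ioo (-Real.pi) Real.pi, ‖F (circleMap z r θ)‖ₑ ^ 2 := by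
  -- The mean value property is applied to the holomorphic function F², and norms are taken inside
  -- the integral.
  have hF2 : DiffContOnCl ℂ (fun ζ => F ζ ^ 2) (Metric.ball z |r|) := by
    refine DifferentiableOn.diffContOnCl ?_
    exact (hF.pow 2).mono Metric.closure_ball_subset_closedBall
  have havg := hF2.circleAverage
  rw [Real.circleAverage_def, inv_smul_eq_iff₀ (by positivity)] at havg
  have hper : Function.Periodic (fun θ => (fun ζ => F ζ ^ 2) (circleMap z r θ)) (2 * Real.pi) :=
    fun θ => by simp only [periodic_circleMap z r θ]
  have hshift := hper.intervalIntegral_add_eq (-Real.pi) 0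
  rw [zero_add, show -Real.pi + 2 * Real.pi = Real.pi by ring,
    intervalIntegral.integral_of_le (by linarith [Real.pi_pos]),
    integral_Ioc_eq_integral_Ioo] at hshift
  rw [← hshift] at havg
  calc ENNReal.ofReal (2 * Real.pi) * ‖F z‖ₑ ^ 2
      = ‖(2 * Real.pi) • F z ^ 2‖ₑ := by
        rw [enorm_smul, enorm_pow, Real.enorm_of_nonneg (by positivity)]
    _ = ‖∫ θ in Ioo (-Real.pi) Real.pi, F (circleMap z r θ) ^ 2‖ₑ := by rw [havg]
    _ ≤ ∫⁻ θ in Ioo (-Real.pi) Real.pi, ‖F (circleMap z r θ) ^ 2‖ₑ :=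
        enorm_integral_le_lintegral_enorm _
    _ = _ := by simp only [enorm_pow]

/-- Sub-mean value property of `‖F‖²` over discs. -/
theorem enorm_sq_le_lintegral_ball {F : ℂ → ℂ} {z : ℂ} {R : ℝ} (hR : 0 ≤ R)
    (hF : DifferentiableOn ℂ F (Metric.ball z R)) :
    ENNReal.ofReal (Real.pi * R ^ 2) * ‖F z‖ₑ ^ 2 ≤ ∫⁻ ζ in Metric.ball z R, ‖F ζ‖ₑ ^ 2 := by
  -- Extension by zero gives a measurable function on the whole plane, to which translation and
  -- polar coordinates apply.
  set q : ℂ → ENNReal := (Metric.ball z R).indicator (fun ζ => ‖F ζ‖ₑ ^ 2) with hq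
  have hqm : Measurable q := by
    have hc : ContinuousOn (fun ζ => ‖F ζ‖ₑ ^ 2) (Metric.ball z R) :=
      (ENNReal.continuous_pow 2).comp_continuousOn hF.continuousOn.enorm
    classical
    rw [hq, ← piecewise_eq_indicator]
    exact hc.measurable_piecewise continuousOn_const Metric.isOpen_ball.measurableSet
  rw [← lintegral_indicator Metric.isOpen_ball.measurableSet, ← hq,
    ← lintegral_add_left_eq_self q z, ← Complex.lintegral_comp_polarCoord_symm]
  have hpolar : ∀ p : ℝ × ℝ, z + Complex.polarCoord.symm p = circleMap z p.1 p.2 := by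
    intro p
    rw [Complex.polarCoord_symm_apply, circleMap, Complex.exp_mul_I, Complex.ofReal_cos,
      Complex.ofReal_sin]
  simp only [hpolar, polarCoord_target, smul_eq_mul]
  have hm : Measurable (fun p : ℝ × ℝ => ENNReal.ofReal p.1 * q (circleMap z p.1 p.2)) := by
    refine (ENNReal.measurable_ofReal.comp measurable_fst).mul (hqm.comp ?_)
    unfold circleMap
    fun_prop
  rw [Measure.volume_eq_prod, ← Measure.prod_restrict, lintegral_prod _ hm.aemeasurable]
  have hrad : ∫⁻ r in Ioo 0 R, ENNReal.ofReal r = ENNReal.ofReal (R ^ 2 / 2) := by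
    rw [← ofReal_integral_eq_lintegral_ofReal, ← integral_Ioc_eq_integral_Ioo,
      ← intervalIntegral.integral_of_le hR, integral_id]
    · simp
    · exact (continuous_id.integrableOn_Icc (a := 0) (b := R)).mono_set Ioo_subset_Icc_self
    · filter_upwards [ae_restrict_mem measurableSet_Ioo] with r hr using hr.1.le
  calc ENNReal.ofReal (Real.pi * R ^ 2) * ‖F z‖ₑ ^ 2
      = ∫⁻ r in Ioo 0 R, ENNReal.ofReal r * (ENNReal.ofReal (2 * Real.pi) * ‖F z‖ₑ ^ 2) := by
        rw [lintegral_mul_const _ ENNReal.measurable_ofReal, hrad, ← mul_assoc,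
          ← ENNReal.ofReal_mul (by positivity)]
        congr 2
        ring
    _ ≤ ∫⁻ r in Ioo 0 R, ∫⁻ θ in Ioo (-Real.pi) Real.pi,
          ENNReal.ofReal r * q (circleMap z r θ) := by
        refine setLIntegral_mono' measurableSet_Ioo fun r hr => ?_
        rw [lintegral_const_mul' _ _ ENNReal.ofReal_ne_top]
        gcongr
        have habs : |r| = r := abs_of_pos hr.1
        refine (two_pi_mul_enorm_sq_le_lintegral_circle (r := r) (hF.mono ?_)).trans
          (le_of_eq ?_)
        · rw [habs]
          exact Metric.closedBall_subset_ball hr.2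
        · refine lintegral_congr fun θ => ?_
          rw [hq, indicator_of_mem]
          rw [Metric.mem_ball, dist_eq_norm, circleMap_sub_center, norm_circleMap_zero, habs]
          exact hr.2
    _ ≤ _ := lintegral_mono_set Ioo_subset_Ioi_self

/-- Point evaluation on `H²`, in terms of a bound for the `L²` norms of the slices. -/
theorem enorm_sq_le_of_eLpNorm_line_le {F : ℂ → ℂ} {z : ℂ} {R : ℝ} {N : ENNReal} (hR : 0 < R)
    (hz : R ≤ z.im) (hF : DifferentiableOn ℂ F {ζ : ℂ | 0 < ζ.im})
    (hN : ∀ y : ℝ, 0 < y → eLpNorm (fun x : ℝ => F (x + y * Complex.I)) 2 volume ≤ N) :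
    ENNReal.ofReal (Real.pi * R) * ‖F z‖ₑ ^ 2 ≤ 2 * N ^ 2 := by
  have hopen : IsOpen {ζ : ℂ | 0 < ζ.im} := isOpen_lt continuous_const Complex.continuous_im
  have him : ∀ ζ ∈ Metric.ball z R, ζ.im ∈ Ioo (z.im - R) (z.im + R) := by
    intro ζ hζ
    rw [Metric.mem_ball, dist_eq_norm] at hζ
    have := (Complex.abs_im_le_norm (ζ - z)).trans_lt hζ
    rw [Complex.sub_im, abs_lt] at this
    exact ⟨by linarith, by linarith⟩
  have hsub : Metric.ball z R ⊆ {ζ : ℂ | 0 < ζ.im} := fun ζ hζ => by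
    have : 0 < ζ.im := by linarith [(him ζ hζ).1]
    exact this
  set q : ℂ → ENNReal := {ζ : ℂ | 0 < ζ.im}.indicator (fun ζ => ‖F ζ‖ₑ ^ 2) with hq
  have hqm : Measurable q := by
    have hc : ContinuousOn (fun ζ => ‖F ζ‖ₑ ^ 2) {ζ : ℂ | 0 < ζ.im} :=
      (ENNReal.continuous_pow 2).comp_continuousOn hF.continuousOn.enorm
    classical
    rw [hq, ← piecewise_eq_indicator]
    exact hc.measurable_piecewise continuousOn_const hopen.measurableSet
  have hline : ∀ y : ℝ, 0 < y → ∫⁻ x : ℝ, q (x + y * Complex.I) ≤ N ^ 2 := by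
    intro y hy
    calc ∫⁻ x : ℝ, q (x + y * Complex.I)
        = ∫⁻ x : ℝ, ‖F (x + y * Complex.I)‖ₑ ^ 2 := by
          refine lintegral_congr fun x => ?_
          rw [hq, indicator_of_mem]
          simpa using hy
      _ = eLpNorm (fun x : ℝ => F (x + y * Complex.I)) 2 volume ^ 2 := by
          rw [eLpNorm_two_sq]
      _ ≤ N ^ 2 := by gcongr; exact hN y hy
  -- The disc lies in a horizontal strip of height 2R, over which Fubini integrates the slice
  -- bounds.
  have key : ENNReal.ofReal (Real.pi * R ^ 2) * ‖F z‖ₑ ^ 2 ≤ ENNReal.ofReal (2 * R) * N ^ 2 :=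
    calc ENNReal.ofReal (Real.pi * R ^ 2) * ‖F z‖ₑ ^ 2
        ≤ ∫⁻ ζ in Metric.ball z R, ‖F ζ‖ₑ ^ 2 := enorm_sq_le_lintegral_ball hR.le (hF.mono hsub)
      _ = ∫⁻ ζ in Metric.ball z R, q ζ :=
          setLIntegral_congr_fun Metric.isOpen_ball.measurableSet
            fun ζ hζ => by rw [hq, indicator_of_mem (hsub hζ)]
      _ ≤ ∫⁻ ζ in Complex.measurableEquivRealProd ⁻¹' (univ ×ˢ Ioo (z.im - R) (z.im + R)), q ζ :=
          lintegral_mono_set fun ζ hζ => ⟨mem_univ _, him ζ hζ⟩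
      _ = ∫⁻ p : ℝ × ℝ in univ ×ˢ Ioo (z.im - R) (z.im + R), q (p.1 + p.2 * Complex.I) := by
          rw [← Complex.volume_preserving_equiv_real_prod.setLIntegral_comp_preimage
            (MeasurableSet.univ.prod measurableSet_Ioo) (by fun_prop)]
          refine lintegral_congr fun ζ => ?_
          rw [Complex.measurableEquivRealProd_apply, Complex.re_add_im]
      _ = ∫⁻ y in Ioo (z.im - R) (z.im + R), ∫⁻ x : ℝ, q (x + y * Complex.I) := by
          rw [Measure.volume_eq_prod, ← Measure.prod_restrict, Measure.restrict_univ,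
            lintegral_prod_symm _ (by fun_prop)]
      _ ≤ ∫⁻ _ in Ioo (z.im - R) (z.im + R), N ^ 2 :=
          setLIntegral_mono' measurableSet_Ioo fun y hy => hline y (by linarith [hy.1])
      _ = ENNReal.ofReal (2 * R) * N ^ 2 := by
          rw [setLIntegral_const, Real.volume_Ioo, mul_comm]
          congr 2
          ring
  have hR0 : ENNReal.ofReal R ≠ 0 := by simpa using hR
  refine (ENNReal.mul_le_mul_iff_right hR0 ENNReal.ofReal_ne_top).mp ?_
  calc ENNReal.ofReal R * (ENNReal.ofReal (Real.pi * R) * ‖F z‖ₑ ^ 2)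
      = ENNReal.ofReal (Real.pi * R ^ 2) * ‖F z‖ₑ ^ 2 := by
        rw [← mul_assoc, ← ENNReal.ofReal_mul hR.le]
        congr 2
        ring
    _ ≤ _ := key
    _ = ENNReal.ofReal R * (2 * N ^ 2) := by
        rw [ENNReal.ofReal_mul zero_le_two, ENNReal.ofReal_ofNat]
        ring

/-! ### Uniqueness and multiplication of boundary data. -/

theorem IsBoundaryValue.ae_eq {f : ℂ → ℂ} {g₁ g₂ : ℝ → ℂ}
    (hf : ∀ y : ℝ, 0 < y → Continuous (fun x : ℝ => f (x + y * Complex.I)))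
    (h₁ : IsBoundaryValue f g₁) (h₂ : IsBoundaryValue f g₂) : g₁ =ᵐ[volume] g₂ := by
  have hle : eLpNorm (g₁ - g₂) 2 volume ≤ 0 := by
    have hlim := h₁.2.add h₂.2
    rw [add_zero] at hlim
    refine ge_of_tendsto hlim ?_
    filter_upwards [self_mem_nhdsWithin] with y hy
    have hm := (hf y hy).aestronglyMeasurable (μ := volume)
    calc eLpNorm (g₁ - g₂) 2 volume
        = eLpNorm ((fun x : ℝ => f (x + y * Complex.I) - g₂ x) -
            fun x : ℝ => f (x + y * Complex.I) - g₁ x) 2 volume := by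
          congr 1
          ext x
          simp
      _ ≤ _ := eLpNorm_sub_le (hm.sub h₂.1.1) (hm.sub h₁.1.1) one_le_two
      _ = _ := add_comm _ _
  have h0 := (eLpNorm_eq_zero_iff (h₁.1.1.sub h₂.1.1) two_ne_zero).mp (le_zero_iff.mp hle)
  filter_upwards [h0] with x hx
  exact sub_eq_zero.mp hx

theorem isBoundaryValue_boundaryValue {f : ℂ → ℂ} (h : ∃ g, IsBoundaryValue f g) :
    IsBoundaryValue f (boundaryValue f) := by
  rw [boundaryValue, dif_pos h]
  exact h.choose_spec

theorem IsBoundaryValue.boundaryValue_ae_eq {f : ℂ → ℂ} {g : ℝ → ℂ} (hf : MemH2 f)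
    (h : IsBoundaryValue f g) : boundaryValue f =ᵐ[volume] g :=
  (isBoundaryValue_boundaryValue ⟨g, h⟩).ae_eq (fun _ hy => hf.continuous_line hy) h

theorem MemH2.mul_left_of_bounded {f h : ℂ → ℂ} (hf : MemH2 f) {B : ℝ}
    (hh : DifferentiableOn ℂ h {ζ : ℂ | 0 < ζ.im}) (hB : ∀ ζ : ℂ, 0 < ζ.im → ‖h ζ‖ ≤ B) :
    MemH2 (fun ζ => h ζ * f ζ) := by
  refine ⟨hh.mul hf.1, ?_⟩
  refine (iSup₂_le fun y hy => ?_ : _ ≤ ENNReal.ofReal B *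
    ⨆ (y : ℝ) (_ : 0 < y), eLpNorm (fun x : ℝ => f (x + y * Complex.I)) 2 volume).trans_lt
      (ENNReal.mul_lt_top ENNReal.ofReal_lt_top hf.2)
  refine (eLpNorm_le_mul_eLpNorm_of_ae_le_mul (c := B)
    (g := fun x : ℝ => f (x + y * Complex.I)) (Eventually.of_forall fun x => ?_) 2).trans
      (by gcongr; exact MemH2.eLpNorm_line_le hy)
  rw [norm_mul]
  gcongr
  exact hB _ (by simpa using hy)

theorem IsBoundaryValue.const_mul {f : ℂ → ℂ} {g : ℝ → ℂ} (h : IsBoundaryValue f g) (c : ℂ) :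
    IsBoundaryValue (fun ζ => c * f ζ) (fun x => c * g x) := by
  refine ⟨h.1.const_mul c, ?_⟩
  have hlim := ENNReal.Tendsto.const_mul (a := ‖c‖ₑ) h.2 (Or.inr enorm_ne_top)
  rw [mul_zero] at hlim
  refine hlim.congr fun y => ?_
  simp only [← mul_sub]
  exact (eLpNorm_const_smul c _ 2 volume).symm

/-! ### The outer factor and its boundary modulus. -/

/-- The outer function `exp ((i/π) L ln ((1 + ζ)/(1 - ζ)))`; its modulus is `1` on `(-1, 1)` and
`exp (-L)` on the rest of the real line. -/
noncomputable def outerFactor (L : ℝ) (ζ : ℂ) : ℂ :=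
  Complex.exp (Complex.I / (Real.pi : ℂ) * (L : ℂ) * Complex.log ((1 + ζ) / (1 - ζ)))

/-- The factor i turns the logarithm's imaginary part into the real part of the exponent, so all
modulus estimates reduce to the range of the argument. -/
theorem norm_outerFactor (L : ℝ) (ζ : ℂ) :
    ‖outerFactor L ζ‖ = Real.exp (-(L * (Complex.arg ((1 + ζ) / (1 - ζ)) / Real.pi))) := by
  rw [outerFactor, Complex.norm_exp]
  congr 1
  rw [show Complex.I / (Real.pi : ℂ) * (L : ℂ) * Complex.log ((1 + ζ) / (1 - ζ)) =
    ((L / Real.pi : ℝ) : ℂ) * (Complex.I * Complex.log ((1 + ζ) / (1 - ζ))) by push_cast; ring,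
    Complex.re_ofReal_mul, Complex.I_mul_re, Complex.log_im]
  ring

theorem im_moebius (ζ : ℂ) :
    ((1 + ζ) / (1 - ζ)).im = 2 * ζ.im / Complex.normSq (1 - ζ) := by
  rw [Complex.div_im]
  simp only [Complex.add_im, Complex.one_im, Complex.sub_re, Complex.one_re, Complex.add_re,
    Complex.sub_im]
  ring

theorem im_moebius_pos {ζ : ℂ} (hζ : 0 < ζ.im) : 0 < ((1 + ζ) / (1 - ζ)).im := by
  rw [im_moebius]
  have : 1 - ζ ≠ 0 := fun h => by
    have := congrArg Complex.im h
    simp at this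
    linarith
  have := Complex.normSq_pos.mpr this
  positivity

theorem im_moebius_nonneg {ζ : ℂ} (hζ : 0 ≤ ζ.im) : 0 ≤ ((1 + ζ) / (1 - ζ)).im := by
  rw [im_moebius]
  exact div_nonneg (by linarith) (Complex.normSq_nonneg _)

theorem norm_outerFactor_le_one {L : ℝ} (hL : 0 ≤ L) {ζ : ℂ} (hζ : 0 ≤ ζ.im) :
    ‖outerFactor L ζ‖ ≤ 1 := by
  rw [norm_outerFactor, Real.exp_le_one_iff, neg_nonpos]
  have := Complex.arg_nonneg_iff.mpr (im_moebius_nonneg hζ)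
  positivity

theorem norm_outerFactor_le_exp {L : ℝ} (hL : L ≤ 0) {ζ : ℂ} :
    ‖outerFactor L ζ‖ ≤ Real.exp (-L) := by
  rw [norm_outerFactor, Real.exp_le_exp]
  have : Complex.arg ((1 + ζ) / (1 - ζ)) / Real.pi ≤ 1 :=
    (div_le_one Real.pi_pos).mpr (Complex.arg_le_pi _)
  nlinarith

theorem moebius_ofReal (x : ℝ) : (1 + (x : ℂ)) / (1 - x) = ((1 + x) / (1 - x) : ℝ) := by
  push_cast
  ring

theorem norm_outerFactor_of_mem_Ioo (L : ℝ) {x : ℝ} (hx : x ∈ Ioo (-1 : ℝ) 1) :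
    ‖outerFactor L x‖ = 1 := by
  rw [norm_outerFactor, moebius_ofReal, Complex.arg_ofReal_of_nonneg]
  · simp
  · exact div_nonneg (by linarith [hx.1]) (by linarith [hx.2])

theorem norm_outerFactor_of_notMem_Icc (L : ℝ) {x : ℝ} (hx : x ∉ Icc (-1 : ℝ) 1) :
    ‖outerFactor L x‖ = Real.exp (-L) := by
  rw [norm_outerFactor, moebius_ofReal, Complex.arg_ofReal_of_neg, div_self Real.pi_pos.ne',
    mul_one]
  rw [mem_Icc, not_and_or, not_le, not_le] at hx
  rcases hx with hx | hx
  · exact div_neg_of_neg_of_pos (by linarith) (by linarith)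
  · exact div_neg_of_pos_of_neg (by linarith) (by linarith)

theorem differentiableOn_outerFactor (L : ℝ) :
    DifferentiableOn ℂ (outerFactor L) {ζ : ℂ | 0 < ζ.im} := by
  intro ζ hζ
  have hζ : 0 < ζ.im := hζ
  have hne : 1 - ζ ≠ 0 := fun h => by
    have := congrArg Complex.im h
    simp at this
    linarith
  have hslit : (1 + ζ) / (1 - ζ) ∈ Complex.slitPlane := Or.inr (im_moebius_pos hζ).ne'
  have hm : DifferentiableAt ℂ (fun ζ : ℂ => (1 + ζ) / (1 - ζ)) ζ :=
    DifferentiableAt.div (by fun_prop) (by fun_prop) hne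
  exact ((hm.clog hslit).const_mul _).cexp.differentiableWithinAt

/-- Off [-1,1] the Möbius image of x lies on the branch cut of the logarithm. The approach stays in
the closed upper half-plane, from which the principal branch is continuous up to the cut. -/
theorem tendsto_outerFactor (L : ℝ) {x : ℝ} (h1 : x ≠ 1) (h2 : x ≠ -1) :
    Tendsto (fun y : ℝ => outerFactor L (x + y * Complex.I)) (𝓝[>] 0) (𝓝 (outerFactor L x)) := by
  have hsub : (1 - (x : ℂ)) ≠ 0 := by
    rw [sub_ne_zero]
    exact_mod_cast h1.symm
  have hne : (1 + x) / (1 - x) ≠ 0 :=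
    div_ne_zero (fun h => h2 (by linarith)) (fun h => h1 (by linarith))
  have hlog : ContinuousWithinAt Complex.log {ζ : ℂ | 0 ≤ ζ.im} ((1 + x) / (1 - x)) := by
    rw [moebius_ofReal]
    rcases hne.lt_or_gt with hneg | hpos
    · exact Complex.continuousWithinAt_log_of_re_neg_of_im_zero (by rwa [Complex.ofReal_re])
        (Complex.ofReal_im _)
    · exact (continuousAt_clog (Complex.ofReal_mem_slitPlane.mpr hpos)).continuousWithinAt
  have hm : Tendsto (fun y : ℝ => (1 + (x + y * Complex.I)) / (1 - (x + y * Complex.I)))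
      (𝓝[>] 0) (𝓝[{ζ : ℂ | 0 ≤ ζ.im}] ((1 + x) / (1 - x))) := by
    refine tendsto_nhdsWithin_iff.mpr ⟨?_, ?_⟩
    · have hc : ContinuousAt
          (fun y : ℝ => (1 + ((x : ℂ) + y * Complex.I)) / (1 - (x + y * Complex.I))) 0 :=
        ContinuousAt.div (by fun_prop) (by fun_prop) (by simpa using hsub)
      have := hc.tendsto
      simp only [Complex.ofReal_zero, zero_mul, add_zero] at this
      exact this.mono_left nhdsWithin_le_nhds
    · filter_upwards [self_mem_nhdsWithin] with y hy
      exact im_moebius_nonneg (le_of_lt (by simpa using hy))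
  exact (Complex.continuous_exp.tendsto _).comp ((hlog.tendsto.comp hm).const_mul _)

theorem ae_tendsto_outerFactor (L : ℝ) : ∀ᵐ x : ℝ,
    Tendsto (fun y : ℝ => outerFactor L (x + y * Complex.I)) (𝓝[>] 0) (𝓝 (outerFactor L x)) := by
  have h : ∀ a : ℝ, ∀ᵐ x : ℝ, x ≠ a := fun a => by simp [ae_iff]
  filter_upwards [h 1, h (-1)] with x h1 h2 using tendsto_outerFactor L h1 h2

/-! ### The exponent γ and the viewing angle. -/

theorem im_add_one_div_sub_one_neg {z : ℂ} (hz : 0 < z.im) : ((z + 1) / (z - 1)).im < 0 := by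
  have := im_moebius_pos hz
  rw [show (z + 1) / (z - 1) = -((1 + z) / (1 - z)) by
    rw [← div_neg, neg_sub, add_comm], Complex.neg_im]
  linarith

/-- The two quotients are negatives of each other, and (z + 1)/(z - 1) lies in the lower half-plane,
where negation adds π to the argument. -/
theorem arg_moebius_div_pi {z : ℂ} (hz : 0 < z.im) :
    Complex.arg ((1 + z) / (1 - z)) / Real.pi = 1 - gammaExp z := by
  rw [show (1 + z) / (1 - z) = -((z + 1) / (z - 1)) by
    rw [← div_neg, neg_sub, add_comm],
    Complex.arg_neg_eq_arg_add_pi_of_im_neg (im_add_one_div_sub_one_neg hz), gammaExp]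
  field_simp
  ring

theorem gammaExp_pos {z : ℂ} (hz : 0 < z.im) : 0 < gammaExp z := by
  have h := Complex.arg_neg_iff.mpr (im_add_one_div_sub_one_neg hz)
  rw [gammaExp, neg_mul, neg_pos]
  exact mul_neg_of_pos_of_neg (by positivity) h

theorem gammaExp_lt_one (z : ℂ) : gammaExp z < 1 := by
  have h := Complex.neg_pi_lt_arg ((z + 1) / (z - 1))
  have hpi := Real.pi_pos
  rw [gammaExp, neg_mul, one_div, inv_mul_eq_div, ← neg_div, div_lt_one hpi]
  linarith

theorem angle_eq_pi_mul_gammaExp {z : ℂ} (hz : 0 < z.im) :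
    EuclideanGeometry.angle (-1 : ℂ) z 1 = Real.pi * gammaExp z := by
  have h := Complex.arg_neg_iff.mpr (im_add_one_div_sub_one_neg hz)
  have h1 : -1 - z ≠ 0 := fun h => by
    have := congrArg Complex.im h
    simp at this
    linarith
  have h2 : 1 - z ≠ 0 := fun h => by
    have := congrArg Complex.im h
    simp at this
    linarith
  rw [EuclideanGeometry.angle, vsub_eq_sub, vsub_eq_sub, Complex.angle_eq_abs_arg h1 h2,
    show (-1 - z) / (1 - z) = (z + 1) / (z - 1) by
      rw [← neg_div_neg_eq]; congr 1 <;> ring, abs_of_neg h, gammaExp]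
  field_simp

theorem norm_outerFactor_log {z : ℂ} (hz : 0 < z.im) {ε : ℝ} (hε : 0 < ε) :
    ‖outerFactor (Real.log ε) z‖ = ε ^ (gammaExp z - 1) := by
  rw [norm_outerFactor, arg_moebius_div_pi hz, Real.rpow_def_of_pos hε]
  congr 1
  ring

theorem norm_outerFactor_neg_log {z : ℂ} (hz : 0 < z.im) {ε : ℝ} (hε : 0 < ε) :
    ‖outerFactor (-Real.log ε) z‖ = ε ^ (1 - gammaExp z) := by
  rw [norm_outerFactor, arg_moebius_div_pi hz, Real.rpow_def_of_pos hε]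
  congr 1
  ring

/-! ### The upper bound. -/

/-- The `L²` norm of the boundary function of `outerFactor L * f` is at most that of
`outerFactor L` times the boundary function of `f`. -/
theorem lintegral_boundaryValue_outerFactor_mul_le {f : ℂ → ℂ} {g G : ℝ → ℂ} {L : ℝ} (hL : 0 ≤ L)
    (hf : MemH2 f) (hg : IsBoundaryValue f g)
    (hG : IsBoundaryValue (fun ζ => outerFactor L ζ * f ζ) G) :
    eLpNorm G 2 volume ^ 2 ≤ ∫⁻ x : ℝ, ‖outerFactor L x * g x‖ₑ ^ 2 := by
  have hcont : ∀ y : ℝ, 0 < y → Continuous (fun x : ℝ => outerFactor L (x + y * Complex.I)) :=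
    fun y hy => continuous_horizontal_line (differentiableOn_outerFactor L).continuousOn hy
  have hbound : ∀ y : ℝ, 0 < y → ∀ x : ℝ, ‖outerFactor L (x + y * Complex.I)‖ ≤ 1 :=
    fun y hy x => norm_outerFactor_le_one hL (by simpa using hy.le)
  have hfin : ∫⁻ x : ℝ, ‖g x‖ₑ ^ 2 ≠ ⊤ := by
    rw [← eLpNorm_two_sq]
    exact ENNReal.pow_ne_top hg.1.2.ne
  have hlim : Tendsto (fun y : ℝ => ∫⁻ x : ℝ, ‖outerFactor L (x + y * Complex.I) * g x‖ₑ ^ 2)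
      (𝓝[>] 0) (𝓝 (∫⁻ x : ℝ, ‖outerFactor L x * g x‖ₑ ^ 2)) := by
    refine tendsto_lintegral_filter_of_dominated_convergence' (fun x => ‖g x‖ₑ ^ 2) ?_ ?_ hfin ?_
    · filter_upwards [self_mem_nhdsWithin] with y hy
      exact (((hcont y hy).aestronglyMeasurable.mul hg.1.1).enorm).pow_const 2
    · filter_upwards [self_mem_nhdsWithin] with y hy
      refine Eventually.of_forall fun x => ?_
      gcongr
      rw [enorm_mul]
      refine mul_le_of_le_one_left' ?_
      rw [← ofReal_norm, ENNReal.ofReal_le_one]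
      exact hbound y hy x
    · filter_upwards [ae_tendsto_outerFactor L] with x hx
      exact ((ENNReal.continuous_pow 2).tendsto _).comp (hx.mul_const (g x)).enorm
  have hroot : Tendsto (fun y : ℝ =>
      eLpNorm (fun x : ℝ => outerFactor L (x + y * Complex.I) * g x) 2 volume) (𝓝[>] 0)
      (𝓝 ((∫⁻ x : ℝ, ‖outerFactor L x * g x‖ₑ ^ 2) ^ (1 / 2 : ℝ))) := by
    refine ((ENNReal.continuous_rpow_const.tendsto _).comp hlim).congr fun y => ?_
    simp only [Function.comp_def, ← eLpNorm_two_sq]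
    rw [← ENNReal.rpow_natCast, ← ENNReal.rpow_mul]
    simp
  have hle : eLpNorm G 2 volume ≤ (∫⁻ x : ℝ, ‖outerFactor L x * g x‖ₑ ^ 2) ^ (1 / 2 : ℝ) := by
    -- Triangle inequality through the slices of the product and then `outerFactor` times `g`: two
    -- errors vanish in the limit and the third term tends to the claimed bound.
    have htot := (hG.2.add hg.2).add hroot
    rw [zero_add, zero_add] at htot
    refine ge_of_tendsto htot ?_
    filter_upwards [self_mem_nhdsWithin] with y hy
    have hmo := (hcont y hy).aestronglyMeasurable (μ := volume)
    have hmf := (hf.continuous_line hy).aestronglyMeasurable (μ := volume)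
    have hsplit : G = (fun x : ℝ => outerFactor L (x + y * Complex.I) * f (x + y * Complex.I)) -
        (fun x : ℝ => outerFactor L (x + y * Complex.I) * f (x + y * Complex.I) - G x) := by
      ext x
      simp
    have hsplit' : (fun x : ℝ => outerFactor L (x + y * Complex.I) * f (x + y * Complex.I)) =
        (fun x : ℝ => outerFactor L (x + y * Complex.I) * (f (x + y * Complex.I) - g x)) +
          fun x : ℝ => outerFactor L (x + y * Complex.I) * g x := by
      ext x
      simp only [Pi.add_apply]
      ring
    calc eLpNorm G 2 volume
        ≤ eLpNorm (fun x : ℝ => outerFactor L (x + y * Complex.I) * f (x + y * Complex.I)) 2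
            volume + eLpNorm (fun x : ℝ =>
              outerFactor L (x + y * Complex.I) * f (x + y * Complex.I) - G x) 2 volume := by
          conv_lhs => rw [hsplit]
          exact eLpNorm_sub_le (hmo.mul hmf) ((hmo.mul hmf).sub hG.1.1) one_le_two
      _ ≤ (eLpNorm (fun x : ℝ => f (x + y * Complex.I) - g x) 2 volume +
            eLpNorm (fun x : ℝ => outerFactor L (x + y * Complex.I) * g x) 2 volume) +
            eLpNorm (fun x : ℝ =>
              outerFactor L (x + y * Complex.I) * f (x + y * Complex.I) - G x) 2 volume := by
          gcongr
          conv_lhs => rw [hsplit']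
          refine (eLpNorm_add_le (hmo.mul (hmf.sub hg.1.1)) (hmo.mul hg.1.1) one_le_two).trans ?_
          refine add_le_add (eLpNorm_mono fun x => ?_) le_rfl
          rw [Pi.mul_apply, norm_mul]
          exact mul_le_of_le_one_left (norm_nonneg _) (hbound y hy x)
      _ = _ := by ring
  calc eLpNorm G 2 volume ^ 2
      ≤ ((∫⁻ x : ℝ, ‖outerFactor L x * g x‖ₑ ^ 2) ^ (1 / 2 : ℝ)) ^ 2 := by gcongr
    _ = _ := by
      rw [← ENNReal.rpow_natCast, ← ENNReal.rpow_mul]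
      simp

theorem lintegral_outerFactor_mul_le {g : ℝ → ℂ} {ε : ℝ} (hε : 0 < ε)
    (h1 : eLpNorm g 2 volume ≤ 1)
    (h2 : eLpNorm g 2 (volume.restrict (Ioo (-1) 1)) ≤ ENNReal.ofReal ε) :
    ∫⁻ x : ℝ, ‖outerFactor (-Real.log ε) x * g x‖ₑ ^ 2 ≤ 2 * ENNReal.ofReal ε ^ 2 := by
  rw [← lintegral_add_compl _ (measurableSet_Ioo (a := (-1 : ℝ)) (b := 1)), two_mul]
  -- The modulus off the interval is known only away from ±1, a null set.
  have hcompl : ((Ioo (-1 : ℝ) 1)ᶜ : Set ℝ) =ᵐ[volume] ((Icc (-1 : ℝ) 1)ᶜ : Set ℝ) :=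
    Ioo_ae_eq_Icc.compl
  refine add_le_add ?_ ?_
  · calc ∫⁻ x in Ioo (-1 : ℝ) 1, ‖outerFactor (-Real.log ε) x * g x‖ₑ ^ 2
        = ∫⁻ x in Ioo (-1 : ℝ) 1, ‖g x‖ₑ ^ 2 := by
          refine setLIntegral_congr_fun measurableSet_Ioo fun x hx => ?_
          simp only [enorm_mul]
          rw [← ofReal_norm, norm_outerFactor_of_mem_Ioo _ hx, ENNReal.ofReal_one, one_mul]
      _ ≤ _ := by
          rw [← eLpNorm_two_sq]
          gcongr
  · calc ∫⁻ x in (Ioo (-1 : ℝ) 1)ᶜ, ‖outerFactor (-Real.log ε) x * g x‖ₑ ^ 2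
        = ∫⁻ x in (Icc (-1 : ℝ) 1)ᶜ, ‖outerFactor (-Real.log ε) x * g x‖ₑ ^ 2 :=
          setLIntegral_congr hcompl
      _ = ∫⁻ x in (Icc (-1 : ℝ) 1)ᶜ, ENNReal.ofReal ε ^ 2 * ‖g x‖ₑ ^ 2 := by
          refine setLIntegral_congr_fun measurableSet_Icc.compl fun x hx => ?_
          simp only [enorm_mul]
          rw [← ofReal_norm, norm_outerFactor_of_notMem_Icc _ hx, neg_neg, Real.exp_log hε, mul_pow]
      _ ≤ ∫⁻ x, ENNReal.ofReal ε ^ 2 * ‖g x‖ₑ ^ 2 := setLIntegral_le_lintegral _ _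
      _ = ENNReal.ofReal ε ^ 2 * eLpNorm g 2 volume ^ 2 := by
          rw [lintegral_const_mul' _ _ (by finiteness), eLpNorm_two_sq]
      _ ≤ _ := mul_le_of_le_one_right' (pow_le_one₀ zero_le h1)

theorem rho_arg_pos {z : ℂ} (hz : 0 < z.im) :
    0 < z.im / 9 * (Real.arctan ((z.re + 1) / z.im) - Real.arctan ((z.re - 1) / z.im)) := by
  have : (z.re - 1) / z.im < (z.re + 1) / z.im := by gcongr; linarith
  have := Real.arctan_strictMono this
  exact mul_pos (by positivity) (by linarith)

theorem rho_pos {z : ℂ} (hz : 0 < z.im) : 0 < rho z :=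
  inv_pos.mpr (Real.sqrt_pos.mpr (rho_arg_pos hz))

/-- The difference of the two arctangents is less than π. -/
theorem nine_le_rho_sq_mul {z : ℂ} (hz : 0 < z.im) : 9 ≤ rho z ^ 2 * (Real.pi * z.im) := by
  have h := rho_arg_pos hz
  rw [rho, inv_pow, Real.sq_sqrt h.le, inv_mul_eq_div, le_div_iff₀ h]
  have h1 := Real.arctan_lt_pi_div_two ((z.re + 1) / z.im)
  have h2 := Real.neg_pi_div_two_lt_arctan ((z.re - 1) / z.im)
  nlinarith

/-- The upper bound in the analytic continuation problem. -/
theorem Admissible.norm_le {z : ℂ} (hz : 0 < z.im) {ε : ℝ} (hε : 0 < ε) (hε1 : ε < 1)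
    {f : ℂ → ℂ} (hf : Admissible ε f) : ‖f z‖ ≤ rho z * ε ^ gammaExp z := by
  obtain ⟨hH, h1, h2⟩ := hf
  obtain ⟨g₀, hg₀, -⟩ := hH.exists_isBoundaryValue
  have hg := isBoundaryValue_boundaryValue ⟨g₀, hg₀⟩
  have hL : 0 ≤ -Real.log ε := by linarith [Real.log_neg hε hε1]
  have hF : MemH2 (fun ζ => outerFactor (-Real.log ε) ζ * f ζ) :=
    hH.mul_left_of_bounded (differentiableOn_outerFactor _)
      fun ζ hζ => norm_outerFactor_le_one hL hζ.le
  obtain ⟨G, hG, hdom⟩ := hF.exists_isBoundaryValue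
  have hGle := (lintegral_boundaryValue_outerFactor_mul_le hL hH hg hG).trans
    (lintegral_outerFactor_mul_le hε h1 h2)
  -- The radius is Im z, the largest for which the disc stays in the half-plane.
  have hev := (enorm_sq_le_of_eLpNorm_line_le hz le_rfl hF.1 hdom).trans
    (mul_le_mul_right hGle 2)
  have hreal : Real.pi * z.im * (ε ^ (1 - gammaExp z) * ‖f z‖) ^ 2 ≤ 2 * (2 * ε ^ 2) := by
    rw [← norm_outerFactor_neg_log hz hε, ← norm_mul]
    rw [← ofReal_norm, ← ENNReal.ofReal_pow (norm_nonneg _), ← ENNReal.ofReal_pow hε.le,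
      ← ENNReal.ofReal_mul (by positivity), ← ENNReal.ofReal_ofNat 2,
      ← ENNReal.ofReal_mul (by norm_num), ← ENNReal.ofReal_mul (by norm_num),
      ENNReal.ofReal_le_ofReal_iff (by positivity)] at hev
    exact hev
  have hpow : ε ^ (1 - gammaExp z) * ε ^ gammaExp z = ε := by
    rw [← Real.rpow_add hε]
    simp
  set s := ε ^ (1 - gammaExp z) with hs
  have hspos : 0 < s := Real.rpow_pos_of_pos hε _
  have hρ := rho_pos hz
  refine le_of_mul_le_mul_left ?_ hspos
  rw [show s * (rho z * ε ^ gammaExp z) = rho z * (s * ε ^ gammaExp z) by ring, hpow]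
  refine le_of_sq_le_sq ?_ (by positivity)
  refine le_of_mul_le_mul_left (a := Real.pi * z.im) ?_ (by positivity)
  -- It remains to compare 4ε² from `hreal` with 9ε².
  have := nine_le_rho_sq_mul hz
  nlinarith [sq_nonneg ε]

/-! ### The kernel p and the near-maximizer W. -/

theorem norm_kernelP (z ζ : ℂ) : ‖kernelP z ζ‖ = ‖ζ - (starRingEnd ℂ) z‖⁻¹ := by
  rw [kernelP, norm_div, Complex.norm_I, one_div]

theorem im_sub_conj_pos {z ζ : ℂ} (hz : 0 < z.im) (hζ : 0 ≤ ζ.im) :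
    0 < (ζ - (starRingEnd ℂ) z).im := by
  rw [Complex.sub_im, Complex.conj_im]
  linarith

theorem sub_conj_ne_zero {z ζ : ℂ} (hz : 0 < z.im) (hζ : 0 ≤ ζ.im) :
    ζ - (starRingEnd ℂ) z ≠ 0 := fun h => by
  have := im_sub_conj_pos hz hζ
  rw [h, Complex.zero_im] at this
  exact this.false

theorem norm_kernelP_pos {z ζ : ℂ} (hz : 0 < z.im) (hζ : 0 ≤ ζ.im) : 0 < ‖kernelP z ζ‖ := by
  rw [norm_kernelP]
  exact inv_pos.mpr (norm_pos_iff.mpr (sub_conj_ne_zero hz hζ))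

/-- Moving upwards increases the distance to the pole, which lies in the lower half-plane. The trace
of p on the line thus dominates all its slices. -/
theorem norm_kernelP_line_le {z : ℂ} (hz : 0 < z.im) (x : ℝ) {y : ℝ} (hy : 0 ≤ y) :
    ‖kernelP z (x + y * Complex.I)‖ ≤ ‖kernelP z x‖ := by
  rw [norm_kernelP, norm_kernelP]
  refine inv_anti₀ (norm_pos_iff.mpr (sub_conj_ne_zero hz (by simp))) ?_
  rw [Complex.norm_def, Complex.norm_def]
  refine Real.sqrt_le_sqrt ?_
  simp only [Complex.normSq_apply, Complex.sub_re, Complex.sub_im, Complex.add_re, Complex.add_im,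
    Complex.mul_re, Complex.mul_im, Complex.ofReal_re, Complex.ofReal_im, Complex.I_re,
    Complex.I_im, Complex.conj_re, Complex.conj_im]
  nlinarith

theorem continuous_kernelP_ofReal {z : ℂ} (hz : 0 < z.im) :
    Continuous (fun x : ℝ => kernelP z x) := by
  unfold kernelP
  exact continuous_const.div (by fun_prop) fun x => sub_conj_ne_zero hz (by simp)

theorem memLp_kernelP {z : ℂ} (hz : 0 < z.im) : MemLp (fun x : ℝ => kernelP z x) 2 volume := by
  rw [memLp_two_iff_integrable_sq_norm (continuous_kernelP_ofReal hz).aestronglyMeasurable]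
  have h := ((integrable_inv_one_add_sq.comp_div hz.ne').comp_sub_right z.re).const_mul
    ((z.im ^ 2)⁻¹)
  refine h.congr (Eventually.of_forall fun x => ?_)
  simp only
  rw [norm_kernelP, inv_pow, ← Complex.normSq_eq_norm_sq, ← mul_inv]
  congr 1
  simp only [Complex.normSq_apply, Complex.sub_re, Complex.sub_im, Complex.ofReal_re,
    Complex.ofReal_im, Complex.conj_re, Complex.conj_im]
  field_simp
  ring

theorem memH2_kernelP {z : ℂ} (hz : 0 < z.im) : MemH2 (kernelP z) := by
  refine ⟨fun ζ hζ => ?_, ?_⟩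
  · have hζ : 0 < ζ.im := hζ
    have h : DifferentiableAt ℂ (fun ζ => Complex.I / (ζ - (starRingEnd ℂ) z)) ζ :=
      DifferentiableAt.div (by fun_prop) (by fun_prop) (sub_conj_ne_zero hz hζ.le)
    exact h.differentiableWithinAt
  · refine lt_of_le_of_lt (iSup₂_le fun y hy => ?_) (memLp_kernelP hz).2
    exact eLpNorm_mono fun x => norm_kernelP_line_le hz x hy.le

theorem eLpNorm_kernelP_Ioo_ne_top {z : ℂ} (hz : 0 < z.im) :
    eLpNorm (fun x : ℝ => kernelP z x) 2 (volume.restrict (Ioo (-1) 1)) ≠ ⊤ :=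
  ((memLp_kernelP hz).restrict _).2.ne

theorem kernelPNorm_pos {z : ℂ} (hz : 0 < z.im) : 0 < kernelPNorm z := by
  refine ENNReal.toReal_pos (fun h => ?_) (eLpNorm_kernelP_Ioo_ne_top hz)
  rw [eLpNorm_eq_zero_iff (continuous_kernelP_ofReal hz).aestronglyMeasurable two_ne_zero] at h
  have hfalse : ∀ᵐ _ : ℝ ∂(volume.restrict (Ioo (-1 : ℝ) 1)), False := by
    filter_upwards [h] with x hx
    have := norm_kernelP_pos (ζ := x) hz (by simp)
    rw [hx] at this
    simp at this
  rw [ae_iff] at hfalse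
  norm_num at hfalse

theorem maximizerW_eq (z : ℂ) (ε : ℝ) :
    maximizerW z ε =
      fun ζ => (ε : ℂ) / (kernelPNorm z : ℂ) * outerFactor (Real.log ε) ζ * kernelP z ζ := by
  ext ζ
  rw [maximizerW, outerFactor]
  ring

theorem norm_maximizerW {z : ℂ} (hz : 0 < z.im) {ε : ℝ} (hε : 0 < ε) (ζ : ℂ) :
    ‖maximizerW z ε ζ‖ =
      ε * ‖outerFactor (Real.log ε) ζ‖ * ((kernelPNorm z)⁻¹ * ‖kernelP z ζ‖) := by
  rw [maximizerW_eq, norm_mul, norm_mul, norm_div, Complex.norm_of_nonneg hε.le,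
    Complex.norm_of_nonneg (kernelPNorm_pos hz).le]
  ring

/-- The prefactor ε absorbs the maximal size 1/ε of the outer factor; this is where uniformity in ε
comes from. -/
theorem norm_maximizerW_le {z : ℂ} (hz : 0 < z.im) {ε : ℝ} (hε : 0 < ε) (hε1 : ε < 1) (ζ : ℂ) :
    ‖maximizerW z ε ζ‖ ≤ (kernelPNorm z)⁻¹ * ‖kernelP z ζ‖ := by
  rw [norm_maximizerW hz hε]
  have hK := kernelPNorm_pos hz
  refine mul_le_of_le_one_left (by positivity) ?_
  have h := norm_outerFactor_le_exp (Real.log_neg hε hε1).le (ζ := ζ)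
  rw [Real.exp_neg, Real.exp_log hε] at h
  calc ε * ‖outerFactor (Real.log ε) ζ‖ ≤ ε * ε⁻¹ := by gcongr
    _ = 1 := mul_inv_cancel₀ hε.ne'

theorem memH2_maximizerW {z : ℂ} (hz : 0 < z.im) {ε : ℝ} (hε : 0 < ε) (hε1 : ε < 1) :
    MemH2 (maximizerW z ε) := by
  rw [maximizerW_eq]
  refine (memH2_kernelP hz).mul_left_of_bounded
    (B := ‖(ε : ℂ) / (kernelPNorm z : ℂ)‖ * Real.exp (-Real.log ε))
    ((differentiableOn_outerFactor _).const_mul _) fun ζ _ => ?_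
  rw [norm_mul]
  gcongr
  exact norm_outerFactor_le_exp (Real.log_neg hε hε1).le

theorem measurable_maximizerW_ofReal (z : ℂ) (ε : ℝ) :
    Measurable (fun x : ℝ => maximizerW z ε x) := by
  unfold maximizerW kernelP
  fun_prop

/-- The formula for W evaluated on the real line serves as boundary data: pointwise convergence
holds off ±1, and a multiple of |p|, independent of the height, dominates. -/
theorem isBoundaryValue_maximizerW {z : ℂ} (hz : 0 < z.im) {ε : ℝ} (hε : 0 < ε) (hε1 : ε < 1) :
    IsBoundaryValue (maximizerW z ε) (fun x : ℝ => maximizerW z ε x) := by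
  set K := kernelPNorm z with hK
  have hKpos : 0 < K := kernelPNorm_pos hz
  have hW := memH2_maximizerW hz hε hε1
  have hp := memLp_kernelP hz
  have hMem : MemLp (fun x : ℝ => maximizerW z ε x) 2 volume :=
    hp.of_le_mul (c := K⁻¹) (measurable_maximizerW_ofReal z ε).aestronglyMeasurable
      (Eventually.of_forall fun x => norm_maximizerW_le hz hε hε1 x)
  refine ⟨hMem, ?_⟩
  have hsq : Tendsto (fun y : ℝ =>
      ∫⁻ x : ℝ, ‖maximizerW z ε (x + y * Complex.I) - maximizerW z ε x‖ₑ ^ 2)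
      (𝓝[>] 0) (𝓝 (∫⁻ _ : ℝ, 0)) := by
    refine tendsto_lintegral_filter_of_dominated_convergence'
      (fun x => ‖((2 * K⁻¹ : ℝ) : ℂ) * kernelP z x‖ₑ ^ 2) ?_ ?_ ?_ ?_
    · filter_upwards [self_mem_nhdsWithin] with y hy
      exact ((hW.continuous_line hy).aestronglyMeasurable.sub hMem.1).enorm.pow_const 2
    · filter_upwards [self_mem_nhdsWithin] with y hy
      refine Eventually.of_forall fun x => ?_
      gcongr
      rw [enorm_le_iff_norm_le, norm_mul, Complex.norm_of_nonneg (by positivity)]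
      have h1 := norm_maximizerW_le hz hε hε1 (x + y * Complex.I)
      have h2 := norm_maximizerW_le hz hε hε1 x
      have h3 := mul_le_mul_of_nonneg_left (norm_kernelP_line_le hz x (le_of_lt hy))
        (inv_pos.mpr hKpos).le
      have h4 := norm_sub_le (maximizerW z ε (x + y * Complex.I)) (maximizerW z ε x)
      linarith
    · rw [← eLpNorm_two_sq]
      exact ENNReal.pow_ne_top (hp.const_mul _).2.ne
    · filter_upwards [ae_tendsto_outerFactor (Real.log ε)] with x hx
      have hpx : Tendsto (fun y : ℝ => kernelP z (x + y * Complex.I)) (𝓝[>] 0)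
          (𝓝 (kernelP z x)) := by
        have hc : ContinuousAt (fun y : ℝ => kernelP z (x + y * Complex.I)) 0 := by
          unfold kernelP
          refine continuousAt_const.div (by fun_prop) ?_
          simpa using sub_conj_ne_zero (ζ := x) hz (by simp)
        have := hc.tendsto
        simp only [Complex.ofReal_zero, zero_mul, add_zero] at this
        exact this.mono_left nhdsWithin_le_nhds
      have hWx : Tendsto (fun y : ℝ => maximizerW z ε (x + y * Complex.I) - maximizerW z ε x)
          (𝓝[>] 0) (𝓝 0) := by
        rw [← sub_self (maximizerW z ε x), maximizerW_eq]
        exact ((hx.const_mul _).mul hpx).sub_const _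
      have := ((ENNReal.continuous_pow 2).tendsto _).comp hWx.enorm
      simpa [Function.comp_def] using this
  rw [lintegral_zero] at hsq
  have hroot := (ENNReal.continuous_rpow_const (y := (1 / 2 : ℝ)).tendsto _).comp hsq
  rw [ENNReal.zero_rpow_of_pos (by norm_num)] at hroot
  refine hroot.congr fun y => ?_
  simp only [Function.comp_def, ← eLpNorm_two_sq]
  rw [← ENNReal.rpow_natCast, ← ENNReal.rpow_mul]
  simp

theorem intervalNorm_maximizerW {z : ℂ} (hz : 0 < z.im) {ε : ℝ} (hε : 0 < ε) (hε1 : ε < 1) :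
    intervalNorm (maximizerW z ε) = ENNReal.ofReal ε := by
  have hae := (isBoundaryValue_maximizerW hz hε hε1).boundaryValue_ae_eq
    (memH2_maximizerW hz hε hε1)
  have hK := kernelPNorm_pos hz
  rw [intervalNorm, eLpNorm_congr_ae (ae_restrict_of_ae hae)]
  calc eLpNorm (fun x : ℝ => maximizerW z ε x) 2 (volume.restrict (Ioo (-1) 1))
      = eLpNorm (((ε * (kernelPNorm z)⁻¹ : ℝ) : ℂ) • fun x : ℝ => kernelP z x) 2
          (volume.restrict (Ioo (-1) 1)) := by
        refine eLpNorm_congr_norm_ae ?_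
        filter_upwards [ae_restrict_mem measurableSet_Ioo] with x hx
        rw [norm_maximizerW hz hε, norm_outerFactor_of_mem_Ioo _ hx, Pi.smul_apply, norm_smul,
          Complex.norm_of_nonneg (by positivity)]
        ring
    _ = ENNReal.ofReal (ε * (kernelPNorm z)⁻¹) * ENNReal.ofReal (kernelPNorm z) := by
        rw [eLpNorm_const_smul, ← ofReal_norm, Complex.norm_of_nonneg (by positivity),
          kernelPNorm, ENNReal.ofReal_toReal (eLpNorm_kernelP_Ioo_ne_top hz)]
    _ = ENNReal.ofReal ε := by
        rw [← ENNReal.ofReal_mul (by positivity), mul_assoc, inv_mul_cancel₀ hK.ne', mul_one]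

theorem h2Norm_maximizerW_le {z : ℂ} (hz : 0 < z.im) {ε : ℝ} (hε : 0 < ε) (hε1 : ε < 1) :
    h2Norm (maximizerW z ε) ≤
      ENNReal.ofReal ((kernelPNorm z)⁻¹ *
        (eLpNorm (fun x : ℝ => kernelP z x) 2 volume).toReal) := by
  have hK := kernelPNorm_pos hz
  rw [h2Norm, eLpNorm_congr_ae ((isBoundaryValue_maximizerW hz hε hε1).boundaryValue_ae_eq
    (memH2_maximizerW hz hε hε1)), ENNReal.ofReal_mul (by positivity),
    ENNReal.ofReal_toReal (memLp_kernelP hz).2.ne]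
  have hle : ∀ᵐ x : ℝ, ‖maximizerW z ε x‖ ≤ (kernelPNorm z)⁻¹ * ‖kernelP z x‖ :=
    Eventually.of_forall fun x => norm_maximizerW_le hz hε hε1 x
  exact eLpNorm_le_mul_eLpNorm_of_ae_le_mul hle 2

/-- Scaling of the two norms of the boundary data. -/
theorem MemH2.admissible_inv_mul {f : ℂ → ℂ} (hf : MemH2 f) {C ε : ℝ} (hC : 1 ≤ C)
    (h1 : h2Norm f ≤ ENNReal.ofReal C) (h2 : intervalNorm f ≤ ENNReal.ofReal ε) :
    Admissible ε (fun ζ => (C : ℂ)⁻¹ * f ζ) := by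
  have hC0 : 0 < C := by linarith
  have hmem : MemH2 (fun ζ => (C : ℂ)⁻¹ * f ζ) :=
    hf.mul_left_of_bounded (B := ‖(C : ℂ)⁻¹‖) (differentiableOn_const _) fun _ _ => le_rfl
  obtain ⟨g₀, hg₀, -⟩ := hf.exists_isBoundaryValue
  have hae := ((isBoundaryValue_boundaryValue ⟨g₀, hg₀⟩).const_mul
    (C : ℂ)⁻¹).boundaryValue_ae_eq hmem
  have hnorm : ‖(C : ℂ)⁻¹‖ₑ = ENNReal.ofReal C⁻¹ := by
    rw [← ofReal_norm, norm_inv, Complex.norm_of_nonneg hC0.le]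
  have hscale : ∀ μ : Measure ℝ, eLpNorm (fun x => (C : ℂ)⁻¹ * boundaryValue f x) 2 μ =
      ENNReal.ofReal C⁻¹ * eLpNorm (boundaryValue f) 2 μ := fun μ => by
    rw [← hnorm]
    exact eLpNorm_const_smul (C : ℂ)⁻¹ _ 2 μ
  refine ⟨hmem, ?_, ?_⟩
  · rw [h2Norm, eLpNorm_congr_ae hae, hscale]
    calc ENNReal.ofReal C⁻¹ * eLpNorm (boundaryValue f) 2 volume
        ≤ ENNReal.ofReal C⁻¹ * ENNReal.ofReal C := by gcongr; exact h1
      _ = 1 := by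
        rw [← ENNReal.ofReal_mul (by positivity), inv_mul_cancel₀ hC0.ne', ENNReal.ofReal_one]
  · rw [intervalNorm, eLpNorm_congr_ae (ae_restrict_of_ae hae), hscale]
    refine (mul_le_of_le_one_left' ?_).trans h2
    rw [ENNReal.ofReal_le_one]
    exact inv_le_one_of_one_le₀ hC

theorem norm_maximizerW_self {z : ℂ} (hz : 0 < z.im) {ε : ℝ} (hε : 0 < ε) :
    ‖maximizerW z ε z‖ = (kernelPNorm z)⁻¹ * ‖kernelP z z‖ * ε ^ gammaExp z := by
  have hpow : ε * ε ^ (gammaExp z - 1) = ε ^ gammaExp z := by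
    rw [Real.rpow_sub_one hε.ne']
    field_simp
  rw [norm_maximizerW hz hε, norm_outerFactor_log hz hε, hpow]
  ring

end HalfPlane

theorem theorem2p2 (z : ℂ) (hz : 0 < z.im) :
    -- the exponent lies in `(0,1)` and is the angular size of `[-1,1]` seen from `z`, over `π`
    (0 < HalfPlane.gammaExp z ∧ HalfPlane.gammaExp z < 1 ∧
      EuclideanGeometry.angle (-1 : ℂ) z 1 = Real.pi * HalfPlane.gammaExp z) ∧
    -- the upper bound
    (∀ ε : ℝ, 0 < ε → ε < 1 → ∀ f : ℂ → ℂ,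
      HalfPlane.Admissible ε f →
        ‖f z‖ ≤ HalfPlane.rho z * ε ^ HalfPlane.gammaExp z) ∧
    -- optimality: `W` attains the bound up to a factor independent of `ε`, and is admissible up to
    -- a factor independent of `ε`
    (∃ c : ℝ, 0 < c ∧ ∃ C : ℝ, 0 < C ∧ ∀ ε : ℝ, 0 < ε → ε < 1 →
      HalfPlane.MemH2 (HalfPlane.maximizerW z ε) ∧
      HalfPlane.intervalNorm (HalfPlane.maximizerW z ε) = ENNReal.ofReal ε ∧
      HalfPlane.h2Norm (HalfPlane.maximizerW z ε) ≤ ENNReal.ofReal C ∧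
      HalfPlane.Admissible ε (fun ζ => (C : ℂ)⁻¹ * HalfPlane.maximizerW z ε ζ) ∧
      ‖HalfPlane.maximizerW z ε z‖ = c * (HalfPlane.rho z * ε ^ HalfPlane.gammaExp z)) := by
  have hK := HalfPlane.kernelPNorm_pos hz
  have hρ := HalfPlane.rho_pos hz
  have hp := HalfPlane.norm_kernelP_pos hz hz.le
  refine ⟨⟨HalfPlane.gammaExp_pos hz, HalfPlane.gammaExp_lt_one z,
    HalfPlane.angle_eq_pi_mul_gammaExp hz⟩,
    fun ε hε hε1 f hf => hf.norm_le hz hε hε1,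
    -- The constant c is forced by the exact value of |W(z)|; C is the ratio of the norms of p on
    -- the line and on the interval.
    (HalfPlane.kernelPNorm z)⁻¹ * ‖HalfPlane.kernelP z z‖ / HalfPlane.rho z, by positivity,
    (HalfPlane.kernelPNorm z)⁻¹ *
      (eLpNorm (fun x : ℝ => HalfPlane.kernelP z x) 2 volume).toReal, ?_⟩
  set C := (HalfPlane.kernelPNorm z)⁻¹ *
    (eLpNorm (fun x : ℝ => HalfPlane.kernelP z x) 2 volume).toReal with hCdef
  -- Needed so that division by C preserves the bound ε on the interval.
  have hC : 1 ≤ C := by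
    rw [hCdef, inv_mul_eq_div, one_le_div hK]
    exact ENNReal.toReal_mono (HalfPlane.memLp_kernelP hz).2.ne (eLpNorm_restrict_le _ _ _ _)
  refine ⟨by linarith, fun ε hε hε1 => ?_⟩
  have hW := HalfPlane.memH2_maximizerW hz hε hε1
  have hI := HalfPlane.intervalNorm_maximizerW hz hε hε1
  have hN := HalfPlane.h2Norm_maximizerW_le hz hε hε1
  refine ⟨hW, hI, hN, hW.admissible_inv_mul hC hN hI.le, ?_⟩
  rw [HalfPlane.norm_maximizerW_self hz hε]
  field_simp
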